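/- Let $d\ge 1$, and for real $\nu$ and $x>0$ let $J_\nu(x)=\sum_{m\ge 0}\frac{(-1)^m}{m!\,\Gamma(m+\nu+1)}\left(\frac x2\right)^{2m+\nu}$ be the Bessel function of the first kind (with $1/\Gamma=0$ at the poles of $\Gamma$). For $\kappa:[0,\infty)\to\mathbb R$ with $z\mapsto\kappa(\|z\|)$ integrable on $\mathbb R^d$, the measure of the stationary kernel $(x,x')\mapsto\kappa(\|x-x'\|)$ is understood through its (signed) density, the Fourier transform $$\mu_\kappa(\omega)=(2\pi)^{-d/2}\int_{\mathbb R^d}e^{-i\langle\omega,z\rangle}\,\kappa(\|z\|)\,dz,\qquad \omega\in\mathbb R^d .$$ Put $$\kappa_0(z)=\tfrac1\pi\arccos\left(\tfrac12z^2-1\right),\qquad \kappa_1(z)=\tfrac{z}{2\pi}\sqrt{4-z^2}\qquad(0\le z\le 2),$$ and $\kappa_0(z)=\kappa_1(z)=0$ for $z>2$. 1. (Zero order.) For unit vectors $x,x'\in\mathbb R^d$ the zero-order arc-cosine kernel satisfies $1-\frac1\pi\arccos\langle x,x'\rangle=\kappa_0(\|x-x'\|)$. The function $z\mapsto\kappa_0(\|z\|)$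 is integrable on $\mathbb R^d$, and for every $\boldsymbol\omega\in\mathbb R^d\setminus\{0\}$, with $\omega=\|\boldsymbol\omega\|$, $$\mu_{\kappa_0}(\boldsymbol\omega)=\frac1\omega\left(\frac2\omega\right)^{\frac d2-1}J_{\frac d2}(2\omega)-\frac1\pi\left(\frac1\omega\right)^{\frac d2}\sum_{j=0}^\infty\frac{(2j)!}{4^j(j!)^2(2j+1)}\int_0^2\left(\tfrac12z^2-1\right)^{2j+1}\omega\,z^{d/2}J_{d/2-1}(z\omega)\,dz ,$$ where all integrals and the series converge absolutely. Integrating by parts, the integrals are $$\int_0^2\left(\tfrac12z^2-1\right)^{2j+1}\omega\,z^{d/2}J_{d/2-1}(z\omega)\,dz=\sum_{k=0}^{2j+1}(-1)^k\frac{(2j+1)!}{(2j+1-k)!}\,\frac{2^{d/2+k}}{\omega^k}\,J_{d/2+k}(2\omega).$$ 2. (Recurrence.) For all real $a,v$ and all $0\le x\le y$ such that $x>0$ or $a+v>0$, the following integrals converge and $$\int_x^y z^aJ_{v+1}(z)\,dz=2v\int_x^y z^{a-1}J_v(z)\,dz-\int_x^y z^aJ_{v-1}(z)\,dz .$$ 3.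 (First order.) The function $z\mapsto\kappa_1(\|z\|)$ is integrable on $\mathbb R^d$, and for every $\boldsymbol\omega\in\mathbb R^d\setminus\{0\}$, with $\omega=\|\boldsymbol\omega\|$, $$\mu_{\kappa_1}(\boldsymbol\omega)=\frac1\pi\left(\frac1\omega\right)^{\frac d2-1}\sum_{j=0}^\infty\frac{-1}{2j-1}\binom{2j}{j}\frac1{16^j}\int_0^2z^{\frac d2+1+2j}J_{\frac d2-1}(z\omega)\,dz ,$$ where all integrals and the series converge absolutely. -/

import Mathlib

/-- The Bessel function of the first kind `J_ν(x)`, for a real order `ν` and `x > 0`, by its power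
series. At the poles of `Γ` the quotient is `0`, which is the usual value of `1 / Γ` there. -/
noncomputable def besselJ (ν x : ℝ) : ℝ :=
  ∑' m : ℕ, (-1 : ℝ) ^ m / ((m.factorial : ℝ) * Real.Gamma ((m : ℝ) + ν + 1)) *
    (x / 2) ^ (2 * (m : ℝ) + ν)

/-- The zero-order arc-cosine kernel on the unit sphere, as a function of `u = ⟪x, x'⟫`. -/
noncomputable def arcCosineZero (u : ℝ) : ℝ :=
  1 - Real.arccos u / Real.pi

/-- The zero-order arc-cosine kernel as a function of the distance `z = ‖x - x'‖ ∈ [0, 2]`,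
extended by `0` to `z > 2`. -/
noncomputable def kappaZero (z : ℝ) : ℝ :=
  if z ≤ 2 then 1 / Real.pi * Real.arccos (z ^ 2 / 2 - 1) else 0

/-- The first-order function `z / (2π) * √(4 - z²)` of the distance `z ∈ [0, 2]`,
extended by `0` to `z > 2`. -/
noncomputable def kappaOne (z : ℝ) : ℝ :=
  if z ≤ 2 then z / (2 * Real.pi) * Real.sqrt (4 - z ^ 2) else 0

/-- The function `z ↦ κ(‖z‖)` on `ℝ^d`, as a complex-valued function. -/
noncomputable def radialFun (d : ℕ) (κ : ℝ → ℝ) (z : EuclideanSpace ℝ (Fin d)) : ℂ :=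
  ((κ ‖z‖ : ℝ) : ℂ)

/-- The Fourier transform `(2π)^(-d/2) ∫ exp(-i ⟪ω, z⟫) f(z) dz` on `ℝ^d`
(angular frequency, unitary normalization). -/
noncomputable def unitaryFourier {d : ℕ} (f : EuclideanSpace ℝ (Fin d) → ℂ)
    (ω : EuclideanSpace ℝ (Fin d)) : ℂ :=
  (((2 * Real.pi) ^ (-((d : ℝ) / 2)) : ℝ) : ℂ) *
    ∫ z : EuclideanSpace ℝ (Fin d), Complex.exp (-(((inner ℝ ω z : ℝ) : ℂ) * Complex.I)) * f z

/-- The density `μ` of the (generally signed) spectral measure of the stationary radial kernel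
`(x, x') ↦ κ(‖x - x'‖)` on `ℝ^d`: the Fourier transform of `z ↦ κ(‖z‖)`. -/
noncomputable def spectralDensity (d : ℕ) (κ : ℝ → ℝ) (ω : EuclideanSpace ℝ (Fin d)) : ℂ :=
  unitaryFourier (radialFun d κ) ω

/-- The coefficients `(2j)! / (4^j (j!)^2 (2j+1))`. -/
noncomputable def arcsinCoeff (j : ℕ) : ℝ :=
  ((2 * j).factorial : ℝ) / (4 ^ j * (j.factorial : ℝ) ^ 2 * (2 * (j : ℝ) + 1))

/-- The integrand `(z²/2 - 1)^(2j+1) ω z^(d/2) J_{d/2-1}(zω)`. -/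
noncomputable def zeroTerm (d j : ℕ) (ω z : ℝ) : ℝ :=
  (z ^ 2 / 2 - 1) ^ (2 * j + 1) * ω * z ^ ((d : ℝ) / 2) * besselJ ((d : ℝ) / 2 - 1) (z * ω)

/-- The integrand `z^(d/2+1+2j) J_{d/2-1}(zω)`. -/
noncomputable def oneTerm (d j : ℕ) (ω z : ℝ) : ℝ :=
  z ^ ((d : ℝ) / 2 + 1 + 2 * (j : ℝ)) * besselJ ((d : ℝ) / 2 - 1) (z * ω)

/-- The coefficients `-1/(2j-1) * binom(2j, j) / 16^j` of `z^(2j)` in `√(4 - z²) / 2`. -/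
noncomputable def sqrtCoeff (j : ℕ) : ℝ :=
  -1 / (2 * (j : ℝ) - 1) * ((2 * j).choose j : ℝ) / 16 ^ j

/-! Write J_ν(z) = (z/2)^ν E_ν(z²/4) with E_ν entire. The real power carries all the behaviour at 0,
so integrability is read off an exponent. Comparing coefficients gives E_ν' = -E_{ν+1} and
E_{ν-1}(x) = ν E_ν(x) - x E_{ν+1}(x). These yield the recurrence and the primitive (z^ν J_ν(zω))' =
ω z^ν J_{ν-1}(zω), which drives the integration by parts.

In polar coordinates the Fourier transform of a radial function is a one-dimensional integral
against the transform of the unit sphere, a Bessel function of order d/2 - 1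
(`integral_toSphere_cexp`, `spectralDensity_eq`). The sphere's transform is summed from its moments.
These come from evaluating the Laplace transform of a Gaussian in two ways: in closed form, and
through polar coordinates, where each moment splits into a spherical moment times a Gamma value.

Both kernels vanish beyond 2, so only an integral over [0, 2] remains. At order zero, arccos = π/2 -
arcsin: the constant integrates exactly and arcsin is expanded. At order one, √(4 - z²)/2 is
expanded in powers of z². Both expansions reach the boundary of their disc of convergence. Termwise
integration there needs absolute summability of the coefficients, which follows by telescoping c_j =
C(2j, j)/4^j (`summable_arcsinCoeff`, `summable_abs_sqrtCoeff`). -/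

open MeasureTheory Set Filter Topology

/-! ### Bessel functions through their entire part -/

/-- The coefficients of the entire part of the Bessel function of order `ν`. -/
noncomputable def besselCoeff (ν : ℝ) (m : ℕ) : ℝ :=
  (-1 : ℝ) ^ m / ((m.factorial : ℝ) * Real.Gamma ((m : ℝ) + ν + 1))

/-- The entire function `E_ν` with `J_ν(z) = (z / 2) ^ ν * E_ν(z ^ 2 / 4)`. -/
noncomputable def besselEntire (ν x : ℝ) : ℝ := ∑' m : ℕ, besselCoeff ν m * x ^ m

/-- No pole has to be excluded: `Real.Gamma` is 0 at its poles, so its inverse there is the true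
value 0 of the entire function 1/Γ. -/
lemma Real.inv_Gamma_eq_self_mul (s : ℝ) :
    (Real.Gamma s)⁻¹ = s * (Real.Gamma (s + 1))⁻¹ := by
  rcases eq_or_ne s 0 with rfl | h
  · simp [Real.Gamma_zero]
  · rw [Real.Gamma_add_one h, mul_inv, ← mul_assoc, mul_inv_cancel₀ h, one_mul]

/-- Once m + s ≥ 1, the functional equation makes |1/Γ(m + s)| nonincreasing in m; the finitely many
earlier values are absorbed by their sum. -/
lemma Real.exists_abs_inv_Gamma_natCast_add_le (s : ℝ) :
    ∃ C : ℝ, ∀ m : ℕ, |(Real.Gamma ((m : ℝ) + s))⁻¹| ≤ C := by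
  obtain ⟨N, hN⟩ := exists_nat_ge (1 - s)
  have hdec : ∀ k : ℕ, |(Real.Gamma (((N + k : ℕ) : ℝ) + s))⁻¹| ≤ |(Real.Gamma ((N : ℝ) + s))⁻¹| := by
    intro k
    induction k with
    | zero => simp
    | succ k ih =>
      refine le_trans ?_ ih
      have h1 : (1 : ℝ) ≤ ((N + k : ℕ) : ℝ) + s := by
        push_cast
        have : (0 : ℝ) ≤ k := Nat.cast_nonneg k
        linarith
      rw [Real.inv_Gamma_eq_self_mul (((N + k : ℕ) : ℝ) + s), abs_mul,
        abs_of_nonneg (by linarith : (0 : ℝ) ≤ ((N + k : ℕ) : ℝ) + s)]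
      have e : ((N + (k + 1) : ℕ) : ℝ) + s = ((N + k : ℕ) : ℝ) + s + 1 := by push_cast; ring
      rw [e]
      exact le_mul_of_one_le_left (abs_nonneg _) h1
  refine ⟨∑ i ∈ Finset.range (N + 1), |(Real.Gamma ((i : ℝ) + s))⁻¹|, fun m => ?_⟩
  have hsum : ∀ i ∈ Finset.range (N + 1), |(Real.Gamma ((i : ℝ) + s))⁻¹| ≤
      ∑ i ∈ Finset.range (N + 1), |(Real.Gamma ((i : ℝ) + s))⁻¹| := fun i hi =>
    Finset.single_le_sum (f := fun i : ℕ => |(Real.Gamma ((i : ℝ) + s))⁻¹|)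
      (fun _ _ => abs_nonneg _) hi
  rcases le_or_gt m N with h | h
  · exact hsum m (Finset.mem_range.2 (by omega))
  · obtain ⟨k, rfl⟩ := Nat.exists_eq_add_of_le h.le
    exact (hdec k).trans (hsum N (by simp))

lemma exists_abs_besselCoeff_le (ν : ℝ) :
    ∃ C : ℝ, 0 ≤ C ∧ ∀ m : ℕ, |besselCoeff ν m| ≤ C / m.factorial := by
  obtain ⟨C, hC⟩ := Real.exists_abs_inv_Gamma_natCast_add_le (ν + 1)
  refine ⟨C, (abs_nonneg _).trans (hC 0), fun m => ?_⟩
  have hm : (0 : ℝ) < m.factorial := by positivity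
  have h := hC m
  rw [← add_assoc, abs_inv] at h
  rw [besselCoeff, abs_div, abs_pow, abs_neg, abs_one, one_pow, abs_mul, Nat.abs_cast,
    one_div, mul_inv, div_eq_inv_mul]
  gcongr

lemma summable_besselCoeff_mul_pow (ν x : ℝ) :
    Summable fun m : ℕ => besselCoeff ν m * x ^ m := by
  obtain ⟨C, -, hC⟩ := exists_abs_besselCoeff_le ν
  refine Summable.of_norm_bounded ((Real.summable_pow_div_factorial |x|).mul_left C) fun m => ?_
  rw [norm_mul, norm_pow, Real.norm_eq_abs, Real.norm_eq_abs]
  calc _ ≤ C / m.factorial * |x| ^ m := by gcongr; exact hC m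
    _ = _ := by ring

/-- Coefficient form of E_ν' = -E_{ν+1}. -/
lemma besselCoeff_succ_mul (ν : ℝ) (m : ℕ) :
    besselCoeff ν (m + 1) * ((m + 1 : ℕ) : ℝ) = -besselCoeff (ν + 1) m := by
  have hm : ((m : ℝ) + 1) ≠ 0 := by positivity
  have hf : (m.factorial : ℝ) ≠ 0 := by positivity
  have e : (((m + 1 : ℕ) : ℝ) + ν + 1) = (m : ℝ) + (ν + 1) + 1 := by push_cast; ring
  rw [besselCoeff, besselCoeff, e, Nat.factorial_succ]
  push_cast
  rw [div_mul_eq_mul_div, pow_succ, mul_assoc ((m : ℝ) + 1), mul_comm _ ((m : ℝ) + 1),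
    mul_div_mul_left _ _ hm]
  ring

/-- Coefficient form of E_{ν-1} = ν E_ν + x E_ν', from the functional equation of 1/Γ at m + ν. -/
lemma besselCoeff_sub_one (ν : ℝ) (m : ℕ) :
    besselCoeff (ν - 1) m = ν * besselCoeff ν m + besselCoeff ν m * m := by
  have h := Real.inv_Gamma_eq_self_mul ((m : ℝ) + ν)
  have e : (m : ℝ) + (ν - 1) + 1 = m + ν := by ring
  rw [besselCoeff, besselCoeff, e, div_eq_mul_inv, mul_inv, h, div_eq_mul_inv, mul_inv]
  ring

lemma hasSum_besselCoeff_deriv (ν x : ℝ) :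
    HasSum (fun m : ℕ => besselCoeff ν m * (m * x ^ (m - 1))) (-besselEntire (ν + 1) x) := by
  rw [← hasSum_nat_add_iff' 1]
  simp only [Finset.sum_range_one, Nat.cast_zero, zero_mul, mul_zero, sub_zero,
    Nat.add_sub_cancel]
  have h := (summable_besselCoeff_mul_pow (ν + 1) x).hasSum.neg
  refine h.congr_fun fun m => ?_
  rw [← mul_assoc, besselCoeff_succ_mul, neg_mul]

/-- Termwise differentiation: on the ball of radius |x| + 1 the differentiated series is dominated
by a multiple of an exponential series. -/
lemma hasDerivAt_besselEntire (ν x : ℝ) :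
    HasDerivAt (besselEntire ν) (-besselEntire (ν + 1) x) x := by
  set R : ℝ := |x| + 1
  obtain ⟨C, hC0, hC⟩ := exists_abs_besselCoeff_le ν
  have hu : Summable fun m : ℕ => C / m.factorial * (m * R ^ (m - 1)) := by
    rw [← summable_nat_add_iff 1]
    refine ((Real.summable_pow_div_factorial R).mul_left C).congr fun m => ?_
    have hm : ((m : ℝ) + 1) ≠ 0 := by positivity
    have hf : (m.factorial : ℝ) ≠ 0 := by positivity
    rw [Nat.factorial_succ, Nat.add_sub_cancel]
    push_cast
    field_simp
  have hx : x ∈ Metric.ball (0 : ℝ) R := by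
    rw [mem_ball_zero_iff, Real.norm_eq_abs]
    exact lt_add_one _
  have hbound : ∀ (m : ℕ) (y : ℝ), y ∈ Metric.ball (0 : ℝ) R →
      ‖besselCoeff ν m * (m * y ^ (m - 1))‖ ≤ C / m.factorial * (m * R ^ (m - 1)) := by
    intro m y hy
    rw [mem_ball_zero_iff, Real.norm_eq_abs] at hy
    rw [norm_mul, norm_mul, norm_pow, Real.norm_eq_abs, Real.norm_eq_abs, Real.norm_eq_abs,
      Nat.abs_cast]
    have h1 : |y| ^ (m - 1) ≤ R ^ (m - 1) := pow_le_pow_left₀ (abs_nonneg y) hy.le _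
    exact mul_le_mul (hC m) (mul_le_mul_of_nonneg_left h1 (Nat.cast_nonneg _)) (by positivity)
      (by positivity)
  have h := hasDerivAt_tsum_of_isPreconnected (g := fun m y => besselCoeff ν m * y ^ m)
    (g' := fun m y => besselCoeff ν m * (m * y ^ (m - 1))) hu Metric.isOpen_ball
    (convex_ball (0 : ℝ) R).isPreconnected (fun m y _ => (hasDerivAt_pow m y).const_mul _)
    hbound hx (summable_besselCoeff_mul_pow ν x) hx
  exact h.congr_deriv (hasSum_besselCoeff_deriv ν x).tsum_eq

@[fun_prop]
lemma continuous_besselEntire (ν : ℝ) : Continuous (besselEntire ν) :=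
  continuous_iff_continuousAt.2 fun x => (hasDerivAt_besselEntire ν x).continuousAt

lemma besselEntire_sub_one (ν x : ℝ) :
    besselEntire (ν - 1) x = ν * besselEntire ν x - x * besselEntire (ν + 1) x := by
  have h1 := (summable_besselCoeff_mul_pow ν x).hasSum.mul_left ν
  have h2 := (hasSum_besselCoeff_deriv ν x).mul_left x
  have h3 := h1.add h2
  rw [sub_eq_add_neg (ν * _), ← mul_neg]
  refine HasSum.tsum_eq (h3.congr_fun fun m => ?_)
  rw [besselCoeff_sub_one]
  rcases m with _ | m
  · simp
  · rw [Nat.add_sub_cancel]; ring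

lemma besselJ_eq (ν : ℝ) {z : ℝ} (hz : 0 < z) :
    besselJ ν z = (z / 2) ^ ν * besselEntire ν (z ^ 2 / 4) := by
  rw [besselJ, besselEntire, ← tsum_mul_left]
  refine tsum_congr fun m => ?_
  have e : (z / 2) ^ (2 * (m : ℝ) + ν) = (z ^ 2 / 4) ^ m * (z / 2) ^ ν := by
    rw [Real.rpow_add (by positivity), show 2 * (m : ℝ) = ((2 * m : ℕ) : ℝ) by push_cast; ring,
      Real.rpow_natCast, pow_mul]
    congr 2; ring
  rw [e, besselCoeff]; ring

lemma rpow_mul_besselJ_mul (a ν : ℝ) {z ω : ℝ} (hz : 0 < z) (hω : 0 < ω) :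
    z ^ a * besselJ ν (z * ω) =
      z ^ (a + ν) * ((ω / 2) ^ ν * besselEntire ν ((z * ω) ^ 2 / 4)) := by
  rw [besselJ_eq ν (mul_pos hz hω), mul_div_assoc, Real.mul_rpow hz.le (by positivity),
    Real.rpow_add hz]
  ring

lemma besselJ_sub_one_add (ν : ℝ) {z : ℝ} (hz : 0 < z) :
    besselJ (ν + 1) z = 2 * ν * (z⁻¹ * besselJ ν z) - besselJ (ν - 1) z := by
  rw [besselJ_eq _ hz, besselJ_eq _ hz, besselJ_eq _ hz, besselEntire_sub_one,
    Real.rpow_add (by positivity), Real.rpow_sub (by positivity), Real.rpow_one]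
  field_simp
  ring

lemma intervalIntegrable_rpow_mul_besselJ (a ν : ℝ) {ω x y : ℝ} (hω : 0 < ω) (hx : 0 ≤ x)
    (hxy : x ≤ y) (h : 0 < x ∨ -1 < a + ν) :
    IntervalIntegrable (fun z => z ^ a * besselJ ν (z * ω)) volume x y := by
  have h1 : IntervalIntegrable (fun z : ℝ => z ^ (a + ν)) volume x y := by
    rcases h with h | h
    · refine ContinuousOn.intervalIntegrable fun z hz => ?_
      rw [uIcc_of_le hxy] at hz
      exact (Real.continuousAt_rpow_const z _ (Or.inl (h.trans_le hz.1).ne')).continuousWithinAt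
    · exact intervalIntegral.intervalIntegrable_rpow' h
  have h2 := h1.mul_continuousOn
    (g := fun z => (ω / 2) ^ ν * besselEntire ν ((z * ω) ^ 2 / 4)) (by fun_prop)
  refine h2.congr fun z hz => ?_
  rw [uIoc_of_le hxy] at hz
  exact (rpow_mul_besselJ_mul a ν (hx.trans_lt hz.1) hω).symm

theorem besselJ_integral_recurrence (a v : ℝ) {x y : ℝ} (hx : 0 ≤ x) (hxy : x ≤ y)
    (h : 0 < x ∨ 0 < a + v) :
    IntervalIntegrable (fun z => z ^ a * besselJ (v + 1) z) volume x y ∧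
    IntervalIntegrable (fun z => z ^ (a - 1) * besselJ v z) volume x y ∧
    IntervalIntegrable (fun z => z ^ a * besselJ (v - 1) z) volume x y ∧
    ∫ z in x..y, z ^ a * besselJ (v + 1) z =
      2 * v * (∫ z in x..y, z ^ (a - 1) * besselJ v z)
        - ∫ z in x..y, z ^ a * besselJ (v - 1) z := by
  have key : ∀ b μ : ℝ, (0 < x ∨ -1 < b + μ) →
      IntervalIntegrable (fun z => z ^ b * besselJ μ z) volume x y := fun b μ hb => by
    simpa using intervalIntegrable_rpow_mul_besselJ b μ one_pos hx hxy hb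
  have h2 := key (a - 1) v (h.imp id fun h => by linarith)
  have h3 := key a (v - 1) (h.imp id fun h => by linarith)
  refine ⟨key a (v + 1) (h.imp id fun h => by linarith), h2, h3, ?_⟩
  rw [← intervalIntegral.integral_const_mul, ← intervalIntegral.integral_sub (h2.const_mul _) h3]
  refine intervalIntegral.integral_congr_ae (ae_of_all _ fun z hz => ?_)
  rw [uIoc_of_le hxy] at hz
  have hz0 : 0 < z := hx.trans_lt hz.1
  rw [besselJ_sub_one_add v hz0, Real.rpow_sub_one hz0.ne']
  ring

/-! ### Integration by parts against Bessel functions -/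

/-- The primitive z^ν J_ν(zω) is kept in the form z^(2ν) times an entire factor, which for ν > 0 is
continuous at 0 with value 0. -/
lemma hasDerivAt_rpow_mul_besselEntire (ν : ℝ) {z ω : ℝ} (hz : 0 < z) (hω : 0 < ω) :
    HasDerivAt (fun z => z ^ (2 * ν) * ((ω / 2) ^ ν * besselEntire ν ((z * ω) ^ 2 / 4)))
      (ω * (z ^ ν * besselJ (ν - 1) (z * ω))) z := by
  have h1 : HasDerivAt (fun z : ℝ => z ^ (2 * ν)) (2 * ν * z ^ (2 * ν - 1)) z :=
    Real.hasDerivAt_rpow_const (Or.inl hz.ne')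
  have h2 : HasDerivAt (fun z : ℝ => (z * ω) ^ 2 / 4) (z * ω ^ 2 / 2) z := by
    have := (((hasDerivAt_id z).mul_const ω).pow 2).div_const 4
    refine this.congr_deriv ?_
    simp; ring
  have h3 := ((hasDerivAt_besselEntire ν ((z * ω) ^ 2 / 4)).comp z h2).const_mul ((ω / 2) ^ ν)
  refine (h1.mul h3).congr_deriv ?_
  rw [rpow_mul_besselJ_mul ν (ν - 1) hz hω, besselEntire_sub_one,
    show ν + (ν - 1) = 2 * ν - 1 by ring, Real.rpow_sub_one hz.ne',
    Real.rpow_sub_one (by positivity : ω / 2 ≠ 0)]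
  simp only [Function.comp_apply]
  field_simp
  ring

/-- The iterated integration by parts. -/
theorem integral_pow_mul_rpow_mul_besselJ (n : ℕ) {ω : ℝ} (hω : 0 < ω) {ν : ℝ} (hν : 0 < ν) :
    ∫ z in (0 : ℝ)..2, (z ^ 2 / 2 - 1) ^ n * (ω * (z ^ ν * besselJ (ν - 1) (z * ω))) =
      ∑ k ∈ Finset.range (n + 1), (-1 : ℝ) ^ k * (n.descFactorial k : ℝ) *
        (2 : ℝ) ^ (ν + (k : ℝ)) / ω ^ k * besselJ (ν + (k : ℝ)) (2 * ω) := by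
  have hV : ∀ ν : ℝ, 0 < ν → ContinuousOn
      (fun z => z ^ (2 * ν) * ((ω / 2) ^ ν * besselEntire ν ((z * ω) ^ 2 / 4))) (uIcc 0 2) :=
    fun ν hν => ((Real.continuous_rpow_const (by positivity)).mul (by fun_prop)).continuousOn
  have hV0 : ∀ ν : ℝ, 0 < ν → (0 : ℝ) ^ (2 * ν) = 0 := fun ν hν =>
    Real.zero_rpow (by positivity)
  have hint : ∀ ν : ℝ, 0 < ν → IntervalIntegrable
      (fun z => ω * (z ^ ν * besselJ (ν - 1) (z * ω))) volume 0 2 := fun ν hν =>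
    (intervalIntegrable_rpow_mul_besselJ ν (ν - 1) hω le_rfl zero_le_two
      (Or.inr (by linarith))).const_mul ω
  have hdV : ∀ ν : ℝ, ∀ z ∈ Ioo (min 0 2) (max (0 : ℝ) 2), HasDerivAt
      (fun z => z ^ (2 * ν) * ((ω / 2) ^ ν * besselEntire ν ((z * ω) ^ 2 / 4)))
      (ω * (z ^ ν * besselJ (ν - 1) (z * ω))) z := fun ν z hz =>
    hasDerivAt_rpow_mul_besselEntire ν (by simpa using hz.1) hω
  have hend : ∀ ν : ℝ, (2 : ℝ) ^ (2 * ν) * ((ω / 2) ^ ν * besselEntire ν ((2 * ω) ^ 2 / 4)) =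
      2 ^ ν * besselJ ν (2 * ω) := fun ν => by
    rw [rpow_mul_besselJ_mul ν ν two_pos hω, two_mul ν]
  induction n generalizing ν with
  | zero =>
    have := intervalIntegral.integral_eq_sub_of_hasDerivAt_of_le zero_le_two
      ((hV ν hν).mono (by rw [uIcc_of_le zero_le_two])) (fun z hz => hdV ν z (by simpa using hz))
      (hint ν hν)
    simp [this, hend, hV0 ν hν]
  | succ n ih =>
    have hu : ∀ z : ℝ, HasDerivAt (fun z : ℝ => (z ^ 2 / 2 - 1) ^ (n + 1))
        ((n + 1 : ℝ) * (z ^ 2 / 2 - 1) ^ n * z) z := fun z => by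
      have h := (((hasDerivAt_id z).pow 2).div_const 2 |>.sub_const 1).pow (n + 1)
      refine h.congr_deriv ?_
      simp
    have hp := intervalIntegral.integral_mul_deriv_eq_deriv_mul_of_hasDerivAt
      (u := fun z : ℝ => (z ^ 2 / 2 - 1) ^ (n + 1))
      (by fun_prop) (hV ν hν) (fun z _ => hu z) (hdV ν)
      (Continuous.intervalIntegrable (by fun_prop) _ _) (hint ν hν)
    -- Differentiating the polynomial releases a factor z, which turns z^ν J_ν into z^(ν+1) J_ν: the
    -- original integrand with ν + 1 for ν and n for n + 1. Hence the induction runs over all ν. At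
    -- z = 2 the polynomial is 1, so the boundary term is the k = 0 summand.
    have e : ∫ z in (0 : ℝ)..2, (n + 1 : ℝ) * (z ^ 2 / 2 - 1) ^ n * z *
          (z ^ (2 * ν) * ((ω / 2) ^ ν * besselEntire ν ((z * ω) ^ 2 / 4))) =
        (n + 1 : ℝ) / ω * ∫ z in (0 : ℝ)..2,
          (z ^ 2 / 2 - 1) ^ n * (ω * (z ^ (ν + 1) * besselJ (ν + 1 - 1) (z * ω))) := by
      rw [← intervalIntegral.integral_const_mul]
      refine intervalIntegral.integral_congr_ae (ae_of_all _ fun z hz => ?_)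
      rw [uIoc_of_le zero_le_two] at hz
      rw [add_sub_cancel_right, rpow_mul_besselJ_mul _ _ hz.1 hω,
        show ν + 1 + ν = 2 * ν + 1 by ring, Real.rpow_add_one hz.1.ne']
      field_simp
    rw [hp, e, ih (by positivity), hend, hV0 ν hν, Finset.sum_range_succ' _ (n + 1), Finset.mul_sum,
      sub_eq_add_neg, ← Finset.sum_neg_distrib, add_comm]
    congr 1
    · refine Finset.sum_congr rfl fun k _ => ?_
      rw [Nat.succ_descFactorial_succ, show ν + 1 + (k : ℝ) = ν + ((k + 1 : ℕ) : ℝ) by push_cast; ring]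
      push_cast
      field_simp
      ring
    · norm_num

/-! ### Series of arcsine and square root up to the boundary -/

/-- The normalized central binomial coefficients `C(2j, j) / 4 ^ j`. -/
noncomputable def centralRatio (j : ℕ) : ℝ := (j.centralBinom : ℝ) / 4 ^ j

lemma centralRatio_pos (j : ℕ) : 0 < centralRatio j :=
  div_pos (Nat.cast_pos.2 j.centralBinom_pos) (by positivity)

lemma centralRatio_zero : centralRatio 0 = 1 := by simp [centralRatio]

lemma centralRatio_succ (j : ℕ) :
    centralRatio (j + 1) = centralRatio j * (2 * j + 1) / (2 * (j + 1)) := by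
  have h : ((j : ℝ) + 1) * ((j + 1).centralBinom : ℝ) = 2 * (2 * j + 1) * j.centralBinom := by
    exact_mod_cast Nat.succ_mul_centralBinom_succ j
  have hj : (j : ℝ) + 1 ≠ 0 := by positivity
  rw [centralRatio, centralRatio, pow_succ]
  field_simp
  linear_combination 2 * h

lemma centralRatio_sub_succ (j : ℕ) :
    centralRatio j - centralRatio (j + 1) = centralRatio j / (2 * (j + 1)) := by
  have hj : (j : ℝ) + 1 ≠ 0 := by positivity
  rw [centralRatio_succ]
  field_simp
  ring

lemma arcsinCoeff_eq (j : ℕ) : arcsinCoeff j = centralRatio j / (2 * j + 1) := by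
  have h : (((2 * j).factorial : ℕ) : ℝ) = j.centralBinom * j.factorial * j.factorial := by
    have := Nat.choose_mul_factorial_mul_factorial (show j ≤ 2 * j by omega)
    rw [show 2 * j - j = j by omega] at this
    exact_mod_cast this.symm
  have hj : (j.factorial : ℝ) ≠ 0 := by positivity
  rw [arcsinCoeff, centralRatio, h]
  field_simp

lemma arcsinCoeff_nonneg (j : ℕ) : 0 ≤ arcsinCoeff j := by
  rw [arcsinCoeff_eq]
  exact div_nonneg (centralRatio_pos j).le (by positivity)

/-- Since j + 1 ≤ 2j + 1, the term c_j/(2j+1) is at most c_j/(j+1) = 2(c_j - c_{j+1}), which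
telescopes to at most 2c_0 = 2. -/
lemma summable_arcsinCoeff : Summable arcsinCoeff := by
  refine summable_of_sum_range_le (c := 2) arcsinCoeff_nonneg fun n => ?_
  have h : ∀ j ∈ Finset.range n,
      arcsinCoeff j ≤ 2 * (centralRatio j - centralRatio (j + 1)) := fun j _ => by
    rw [arcsinCoeff_eq, centralRatio_sub_succ, div_le_iff₀ (by positivity), mul_div_assoc',
      div_mul_eq_mul_div, le_div_iff₀ (by positivity)]
    nlinarith [mul_nonneg (centralRatio_pos j).le (Nat.cast_nonneg (α := ℝ) j), centralRatio_pos j]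
  refine (Finset.sum_le_sum h).trans ?_
  rw [← Finset.mul_sum, Finset.sum_range_sub', centralRatio_zero]
  linarith [centralRatio_pos n]

/-- Identifies the coefficients of the binomial series of (1 - x)^(-1/2), through the rising
factorial (1/2)(3/2)⋯(n - 1/2) = n! c_n. -/
lemma choose_half_add_sub_one (n : ℕ) :
    Ring.choose ((1 / 2 : ℝ) + n - 1) n = centralRatio n := by
  have h1 : Ring.choose ((1 / 2 : ℝ) + n - 1) n = Ring.multichoose (1 / 2 : ℝ) n := by
    rw [Ring.choose]; congr 1; ring
  rw [h1]
  have h2 : ∀ n : ℕ, (ascPochhammer ℝ n).eval (1 / 2 : ℝ) = n.factorial * centralRatio n := by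
    intro n
    induction n with
    | zero => simp [centralRatio_zero]
    | succ n ih =>
      have hn : (n : ℝ) + 1 ≠ 0 := by positivity
      rw [ascPochhammer_succ_eval, ih, centralRatio_succ, Nat.factorial_succ]
      push_cast
      field_simp
      ring
  have h3 := Ring.factorial_nsmul_multichoose_eq_ascPochhammer (1 / 2 : ℝ) n
  rw [Polynomial.ascPochhammer_smeval_eq_eval, h2, nsmul_eq_mul] at h3
  exact mul_left_cancel₀ (by positivity) h3

lemma hasSum_centralRatio_mul_pow {x : ℝ} (hx : |x| < 1) :
    HasSum (fun j => centralRatio j * x ^ j) (√(1 - x))⁻¹ := by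
  have h := (Real.one_div_one_sub_rpow_hasFPowerSeriesOnBall_zero (1 / 2)).hasSum
    (y := x) (by simpa [enorm_eq_nnnorm, ← NNReal.coe_lt_coe] using hx)
  simp only [zero_add, FormalMultilinearSeries.ofScalars_apply_eq, choose_half_add_sub_one,
    smul_eq_mul] at h
  rwa [Real.sqrt_eq_rpow, ← one_div]

lemma summable_arcsinCoeff_mul_pow {x : ℝ} (hx : |x| ≤ 1) :
    Summable fun j => arcsinCoeff j * x ^ (2 * j + 1) := by
  refine Summable.of_norm_bounded summable_arcsinCoeff fun j => ?_
  rw [norm_mul, norm_pow, Real.norm_eq_abs, Real.norm_eq_abs, abs_of_nonneg (arcsinCoeff_nonneg j)]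
  exact mul_le_of_le_one_right (arcsinCoeff_nonneg j) (pow_le_one₀ (abs_nonneg x) hx)

lemma hasDerivAt_arcsin_series {x : ℝ} (hx : |x| < 1) :
    HasDerivAt (fun x => ∑' j, arcsinCoeff j * x ^ (2 * j + 1)) (√(1 - x ^ 2))⁻¹ x := by
  obtain ⟨r, hxr, hr⟩ := exists_between hx
  have hr0 : 0 < r := (abs_nonneg x).trans_lt hxr
  have hx2 : |x ^ 2| < 1 := by
    rw [abs_pow]; exact pow_lt_one₀ (abs_nonneg x) hx two_ne_zero
  have hr2 : |r ^ 2| < 1 := by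
    rw [abs_pow, abs_of_pos hr0]; exact pow_lt_one₀ hr0.le hr two_ne_zero
  have hd : ∀ j x, HasDerivAt (fun x : ℝ => arcsinCoeff j * x ^ (2 * j + 1))
      (centralRatio j * (x ^ 2) ^ j) x := fun j x => by
    refine ((hasDerivAt_pow (2 * j + 1) x).const_mul (arcsinCoeff j)).congr_deriv ?_
    rw [arcsinCoeff_eq, ← pow_mul]
    rw [Nat.add_sub_cancel]
    push_cast
    field_simp
  have hmem : x ∈ Metric.ball (0 : ℝ) r := by rwa [mem_ball_zero_iff, Real.norm_eq_abs]
  have h := hasDerivAt_tsum_of_isPreconnected (g := fun j x => arcsinCoeff j * x ^ (2 * j + 1))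
    (g' := fun j x => centralRatio j * (x ^ 2) ^ j) (hasSum_centralRatio_mul_pow hr2).summable
    Metric.isOpen_ball (convex_ball (0 : ℝ) r).isPreconnected (fun j y _ => hd j y)
    (fun j y hy => ?_) hmem (summable_arcsinCoeff_mul_pow hx.le) hmem
  · exact h.congr_deriv (hasSum_centralRatio_mul_pow hx2).tsum_eq
  · rw [mem_ball_zero_iff, Real.norm_eq_abs] at hy
    rw [norm_mul, norm_pow, norm_pow, Real.norm_eq_abs, Real.norm_eq_abs,
      abs_of_pos (centralRatio_pos j)]
    exact mul_le_mul_of_nonneg_left (pow_le_pow_left₀ (by positivity)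
      (pow_le_pow_left₀ (abs_nonneg y) hy.le 2) j) (centralRatio_pos j).le

/-- The series and arcsin have the same derivative on (-1, 1) and agree at 0. -/
lemma hasSum_arcsin {x : ℝ} (hx : |x| < 1) :
    HasSum (fun j => arcsinCoeff j * x ^ (2 * j + 1)) (Real.arcsin x) := by
  have hA : ∀ y ∈ Ioo (-1 : ℝ) 1, HasDerivAt Real.arcsin (√(1 - y ^ 2))⁻¹ y := fun y hy => by
    rw [← one_div]
    exact Real.hasDerivAt_arcsin hy.1.ne' hy.2.ne
  have hS : ∀ y ∈ Ioo (-1 : ℝ) 1, HasDerivAt (fun x => ∑' j, arcsinCoeff j * x ^ (2 * j + 1))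
      (√(1 - y ^ 2))⁻¹ y := fun y hy => hasDerivAt_arcsin_series (abs_lt.2 hy)
  have heq : EqOn (fun x => ∑' j, arcsinCoeff j * x ^ (2 * j + 1)) Real.arcsin (Ioo (-1) 1) :=
    isOpen_Ioo.eqOn_of_deriv_eq isPreconnected_Ioo
      (fun y hy => (hS y hy).differentiableAt.differentiableWithinAt)
      (fun y hy => (hA y hy).differentiableAt.differentiableWithinAt)
      (fun y hy => by rw [(hS y hy).deriv, (hA y hy).deriv])
      (x := 0) (by simp) (by simp)
  have := heq (abs_lt.1 hx)
  rw [← this]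
  exact (summable_arcsinCoeff_mul_pow hx.le).hasSum

lemma sqrtCoeff_eq (j : ℕ) : sqrtCoeff j = -(centralRatio j / (2 * j - 1)) / 4 ^ j := by
  have h4 : (16 : ℝ) ^ j = 4 ^ j * 4 ^ j := by rw [← mul_pow]; norm_num
  rw [sqrtCoeff, centralRatio, Nat.centralBinom, h4]
  simp only [div_eq_mul_inv, mul_inv]
  ring

/-- Reflects √(1 - x) = (1 - x)(1 - x)^(-1/2) with x = z²/4: multiplying by 1 - x takes differences
of consecutive c_j. -/
lemma sqrtCoeff_succ (j : ℕ) :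
    sqrtCoeff (j + 1) * 4 ^ (j + 1) = centralRatio (j + 1) - centralRatio j := by
  rw [sqrtCoeff_eq, div_mul_cancel₀ _ (by positivity),
    ← neg_sub (centralRatio j), centralRatio_sub_succ, centralRatio_succ]
  have h2 : (2 : ℝ) * j + 1 ≠ 0 := by positivity
  have h3 : 2 * ((j + 1 : ℕ) : ℝ) - 1 = 2 * j + 1 := by push_cast; ring
  rw [h3]
  field_simp

lemma hasSum_sqrtCoeff {z : ℝ} (hz : |z| < 2) :
    HasSum (fun j => sqrtCoeff j * z ^ (2 * j)) (√(4 - z ^ 2) / 2) := by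
  have hz2 : z ^ 2 < 4 := by
    rw [← sq_abs]; nlinarith [abs_nonneg z]
  set x : ℝ := z ^ 2 / 4
  have hx0 : 0 ≤ x := by positivity
  have hx1 : x < 1 := by simp only [x]; linarith
  have h := hasSum_centralRatio_mul_pow (x := x) (by rwa [abs_of_nonneg hx0])
  have h1 : HasSum (fun j => centralRatio (j + 1) * x ^ (j + 1)) ((√(1 - x))⁻¹ - 1) := by
    have := (hasSum_nat_add_iff' 1).2 h
    simpa [centralRatio_zero] using this
  have h2 := h1.sub (h.mul_right x)
  rw [← hasSum_nat_add_iff' 1]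
  have hpos : 0 < 1 - x := by linarith
  have hs : √(4 - z ^ 2) / 2 = √(1 - x) := by
    rw [show 4 - z ^ 2 = 2 ^ 2 * (1 - x) by simp only [x]; ring, Real.sqrt_mul (by positivity),
      Real.sqrt_sq zero_le_two]
    ring
  have hv : √(4 - z ^ 2) / 2 - ∑ j ∈ Finset.range 1, sqrtCoeff j * z ^ (2 * j) =
      (√(1 - x))⁻¹ - 1 - (√(1 - x))⁻¹ * x := by
    have h0 : sqrtCoeff 0 = 1 := by simp [sqrtCoeff]
    have hq : √(1 - x) ≠ 0 := (Real.sqrt_pos.2 hpos).ne'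
    rw [hs, Finset.sum_range_one, h0, mul_zero, pow_zero]
    field_simp
    linear_combination Real.sq_sqrt hpos.le
  rw [hv]
  refine h2.congr_fun fun j => ?_
  have e : z ^ (2 * (j + 1)) = 4 ^ (j + 1) * x ^ (j + 1) := by
    rw [pow_mul, ← mul_pow]; congr 1; simp only [x]; ring
  rw [e, ← mul_assoc, sqrtCoeff_succ]
  ring

/-- The weight 4^j is the value of z^(2j) at the endpoint z = 2. After the first term, the summands
are c_j/(2(j+1)) ≤ c_j/(2j+1). -/
lemma summable_abs_sqrtCoeff : Summable fun j => |sqrtCoeff j| * 4 ^ j := by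
  rw [← summable_nat_add_iff 1]
  refine Summable.of_nonneg_of_le (fun j => by positivity) (fun j => ?_) summable_arcsinCoeff
  rw [← abs_of_pos (by positivity : (0 : ℝ) < 4 ^ (j + 1)), ← abs_mul, sqrtCoeff_succ, abs_sub_comm,
    centralRatio_sub_succ, arcsinCoeff_eq, abs_of_nonneg (div_nonneg (centralRatio_pos j).le
    (by positivity))]
  exact div_le_div_of_nonneg_left (centralRatio_pos j).le (by positivity) (by linarith)

/-! ### Polar coordinates -/

section Polar
variable {E : Type*} [NormedAddCommGroup E] [NormedSpace ℝ E] [MeasurableSpace E] [BorelSpace E]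
  [FiniteDimensional ℝ E] (μ : Measure E) [μ.IsAddHaarMeasure]
  {F : Type*} [NormedAddCommGroup F]

lemma integrable_toSphere_prod {f : E → F} (hf : Integrable f μ) :
    Integrable (fun p : Metric.sphere (0 : E) 1 × Ioi (0 : ℝ) => f ((p.2 : ℝ) • (p.1 : E)))
      (μ.toSphere.prod (Measure.volumeIoiPow (Module.finrank ℝ E - 1))) := by
  rw [← μ.measurePreserving_homeomorphUnitSphereProd.integrable_comp_emb
    (Homeomorph.measurableEmbedding _)]
  have h : Integrable (fun x : ({0}ᶜ : Set E) => f x) (μ.comap (↑)) := by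
    have := hf.integrableOn (s := {0}ᶜ)
    rwa [integrableOn_iff_comap_subtypeVal (measurableSet_singleton (0 : E)).compl] at this
  refine h.congr (ae_of_all _ fun x => ?_)
  have hx : ‖(x : E)‖ ≠ 0 := norm_ne_zero_iff.2 x.2
  simp [smul_smul, hx]

variable [NormedSpace ℝ F]

lemma integral_eq_integral_toSphere_prod [Nontrivial E] (f : E → F) :
    ∫ x, f x ∂μ = ∫ p : Metric.sphere (0 : E) 1 × Ioi (0 : ℝ), f ((p.2 : ℝ) • (p.1 : E))
      ∂(μ.toSphere.prod (Measure.volumeIoiPow (Module.finrank ℝ E - 1))) := by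
  have h := μ.measurePreserving_homeomorphUnitSphereProd.integral_comp
    (Homeomorph.measurableEmbedding _) (fun p => f ((p.2 : ℝ) • (p.1 : E)))
  have h0 : ∫ x, f x ∂μ = ∫ x : ({0}ᶜ : Set E), f x ∂(μ.comap (↑)) := by
    rw [integral_subtype_comap (measurableSet_singleton (0 : E)).compl f, restrict_compl_singleton]
  rw [← h, h0]
  refine integral_congr_ae (ae_of_all _ fun x => ?_)
  have hx : ‖(x : E)‖ ≠ 0 := norm_ne_zero_iff.2 x.2
  simp [smul_smul, hx]

lemma integral_volumeIoiPow (n : ℕ) (g : ℝ → F) :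
    ∫ x : Ioi (0 : ℝ), g x ∂(Measure.volumeIoiPow n) = ∫ r in Ioi (0 : ℝ), r ^ n • g r := by
  simp only [Measure.volumeIoiPow, ENNReal.ofReal]
  rw [integral_withDensity_eq_integral_smul,
    integral_subtype_comap measurableSet_Ioi fun a ↦ Real.toNNReal (a ^ n) • g a,
    setIntegral_congr_fun measurableSet_Ioi fun x hx ↦ ?_]
  · rw [NNReal.smul_def, Real.coe_toNNReal _ (pow_nonneg hx.out.le _)]
  · exact (measurable_subtype_coe.pow_const _).real_toNNReal

lemma integral_eq_integral_Ioi_integral_toSphere [Nontrivial E] {f : E → F} (hf : Integrable f μ) :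
    ∫ x, f x ∂μ = ∫ r in Ioi (0 : ℝ), r ^ (Module.finrank ℝ E - 1) •
      ∫ θ : Metric.sphere (0 : E) 1, f (r • (θ : E)) ∂μ.toSphere := by
  rw [integral_eq_integral_toSphere_prod, integral_prod_symm _ (integrable_toSphere_prod μ hf),
    integral_volumeIoiPow (g := fun r => ∫ θ : Metric.sphere (0 : E) 1, f (r • (θ : E)) ∂μ.toSphere)]

end Polar

/-! ### Moments and Fourier transform of the unit sphere -/

section Moments

/-- Both series are power series of f at 0, and such a series is unique. -/
lemma eq_of_hasSum_pow_eq {a b : ℕ → ℂ} {f : ℂ → ℂ}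
    (ha : ∀ c, HasSum (fun n => a n * c ^ n) (f c)) (hb : ∀ c, HasSum (fun n => b n * c ^ n) (f c)) :
    a = b := by
  have key : ∀ a : ℕ → ℂ, (∀ c, HasSum (fun n => a n * c ^ n) (f c)) →
      HasFPowerSeriesOnBall f (FormalMultilinearSeries.ofScalars ℂ a) 0 1 := fun a ha => by
    refine ⟨?_, one_pos, fun {y} _ => ?_⟩
    · refine FormalMultilinearSeries.le_radius_of_summable_norm (r := 1) _ ?_
      have := (ha 1).summable.norm
      simpa [FormalMultilinearSeries.ofScalars_norm] using this
    · simpa [FormalMultilinearSeries.ofScalars_apply_eq, mul_comm] using ha y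
  have h := (key a ha).hasFPowerSeriesAt.eq_formalMultilinearSeries (key b hb).hasFPowerSeriesAt
  exact FormalMultilinearSeries.ofScalars_series_injective ℂ ℂ h

lemma hasSum_gaussian_transform {V : Type*} [NormedAddCommGroup V] [InnerProductSpace ℝ V]
    (w : V) (c : ℂ) :
    HasSum (fun n : ℕ => (if Even n then (Real.pi : ℂ) ^ (Module.finrank ℝ V / 2 : ℂ) *
        ((‖w‖ ^ n / (4 ^ (n / 2) * (n / 2).factorial) : ℝ) : ℂ) else 0) * c ^ n)
      ((Real.pi : ℂ) ^ (Module.finrank ℝ V / 2 : ℂ) * Complex.exp (c ^ 2 * ‖w‖ ^ 2 / 4)) := by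
  rw [← add_zero (_ * Complex.exp _)]
  refine HasSum.even_add_odd ?_ ?_
  · have h : HasSum (fun m : ℕ => (c ^ 2 * ‖w‖ ^ 2 / 4 : ℂ) ^ m / m.factorial)
        (Complex.exp (c ^ 2 * ‖w‖ ^ 2 / 4)) := by
      rw [Complex.exp_eq_exp_ℂ]
      exact NormedSpace.expSeries_div_hasSum_exp _
    refine (h.mul_left _).congr_fun fun m => ?_
    rw [if_pos (even_two_mul m), Nat.mul_div_cancel_left m two_pos, pow_mul, pow_mul]
    push_cast
    simp only [div_pow, mul_pow]
    field_simp
  · refine hasSum_zero.congr_fun fun m => ?_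
    rw [if_neg (by simp), zero_mul]

variable {V : Type*} [NormedAddCommGroup V] [InnerProductSpace ℝ V] [FiniteDimensional ℝ V]
  [MeasurableSpace V] [BorelSpace V]

/-- Completing the square, a r - r² ≤ a²/2 - r²/2, so a wider Gaussian dominates. -/
lemma integrable_exp_mul_norm_sub_sq (a : ℝ) :
    Integrable (fun v : V => Real.exp (a * ‖v‖) * Real.exp (-‖v‖ ^ 2)) := by
  have h1 := (GaussianFourier.integrable_cexp_neg_mul_sq_norm_add (V := V) (b := 1 / 2)
    (by norm_num) 0 0).norm.const_mul (Real.exp (a ^ 2 / 2))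
  refine h1.mono' (by fun_prop) (ae_of_all _ fun v => ?_)
  rw [Real.norm_of_nonneg (by positivity), ← Real.exp_add, Complex.norm_exp, ← Real.exp_add]
  have e : (-(1 / 2 : ℂ) * (‖v‖ : ℂ) ^ 2 + 0 * ((inner ℝ 0 v : ℝ) : ℂ)).re = -(1 / 2) * ‖v‖ ^ 2 := by
    rw [zero_mul, add_zero, show -(1 / 2 : ℂ) * (‖v‖ : ℂ) ^ 2 = ((-(1 / 2) * ‖v‖ ^ 2 : ℝ) : ℂ) by
      push_cast; ring, Complex.ofReal_re]
  rw [e]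
  refine Real.exp_le_exp.2 ?_
  nlinarith [sq_nonneg (a - ‖v‖)]

/-- The power series of the Laplace transform of a Gaussian. -/
lemma hasSum_gaussian_moments (w : V) (c : ℂ) :
    HasSum (fun n : ℕ => (((n.factorial : ℂ))⁻¹ *
        ∫ v : V, ((inner ℝ w v : ℝ) : ℂ) ^ n * Complex.exp (-(‖v‖ : ℂ) ^ 2)) * c ^ n)
      ((Real.pi : ℂ) ^ (Module.finrank ℝ V / 2 : ℂ) * Complex.exp (c ^ 2 * ‖w‖ ^ 2 / 4)) := by
  have hg := GaussianFourier.integral_cexp_neg_mul_sq_norm_add (V := V) (b := 1) (by norm_num) c w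
  rw [div_one, mul_one] at hg
  rw [← hg]
  have hexp : ∀ v : V, ‖Complex.exp (-(‖v‖ : ℂ) ^ 2)‖ = Real.exp (-‖v‖ ^ 2) := fun v => by
    rw [← Complex.ofReal_pow, ← Complex.ofReal_neg, Complex.norm_exp_ofReal]
  have hsum : ∀ v : V, Summable fun n : ℕ =>
      (‖c‖ * ‖w‖ * ‖v‖) ^ n / n.factorial * Real.exp (-‖v‖ ^ 2) := fun v =>
    (Real.summable_pow_div_factorial (‖c‖ * ‖w‖ * ‖v‖)).mul_right (Real.exp (-‖v‖ ^ 2))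
  have h := hasSum_integral_of_dominated_convergence (ι := ℕ) (μ := (volume : Measure V))
    (F := fun n v => (c * ((inner ℝ w v : ℝ) : ℂ)) ^ n / n.factorial * Complex.exp (-(‖v‖ : ℂ) ^ 2))
    (f := fun v => Complex.exp (-1 * (‖v‖ : ℂ) ^ 2 + c * ((inner ℝ w v : ℝ) : ℂ)))
    (fun n v => (‖c‖ * ‖w‖ * ‖v‖) ^ n / n.factorial * Real.exp (-‖v‖ ^ 2))
    (fun n => Continuous.aestronglyMeasurable (by fun_prop)) (fun n => ae_of_all _ fun v => ?_)
    (ae_of_all _ hsum) ?_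
    (ae_of_all _ fun v => ?_)
  · refine h.congr_fun fun n => ?_
    rw [← integral_const_mul, mul_comm, ← integral_const_mul]
    refine integral_congr_ae (ae_of_all _ fun v => ?_)
    simp only [mul_pow, div_eq_mul_inv]
    ring
  · rw [norm_mul, hexp, norm_div, norm_pow, norm_mul, Complex.norm_natCast, Complex.norm_real,
      mul_assoc ‖c‖]
    gcongr
    exact norm_inner_le_norm w v
  · refine (integrable_exp_mul_norm_sub_sq (V := V) (‖c‖ * ‖w‖)).congr (ae_of_all _ fun v => ?_)
    simp only
    rw [tsum_mul_right, Real.exp_eq_exp_ℝ, NormedSpace.exp_eq_tsum_div]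
  · rw [neg_one_mul, add_comm, Complex.exp_add]
    refine HasSum.mul_right _ ?_
    rw [Complex.exp_eq_exp_ℂ]
    exact NormedSpace.expSeries_div_hasSum_exp _

/-- The moments of the uniform measure on the unit sphere. -/
noncomputable def sphereMoment (w : V) (n : ℕ) : ℂ :=
  ∫ θ : Metric.sphere (0 : V) 1, ((inner ℝ w (θ : V) : ℝ) : ℂ) ^ n ∂(volume : Measure V).toSphere

/-- In polar coordinates ⟨w, rθ⟩^n = r^n ⟨w, θ⟩^n, so the integrand is a product; the radial factor
is a Gamma integral. -/
lemma gaussian_moment_eq [Nontrivial V] (w : V) (n : ℕ) :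
    ∫ v : V, ((inner ℝ w v : ℝ) : ℂ) ^ n * Complex.exp (-(‖v‖ : ℂ) ^ 2) =
      sphereMoment w n * ((1 / 2 * Real.Gamma (((n : ℝ) + Module.finrank ℝ V) / 2) : ℝ) : ℂ) := by
  have hd : 1 ≤ Module.finrank ℝ V := Module.finrank_pos
  have e : ∀ p : Metric.sphere (0 : V) 1 × Ioi (0 : ℝ),
      ((inner ℝ w ((p.2 : ℝ) • (p.1 : V)) : ℝ) : ℂ) ^ n *
        Complex.exp (-(‖(p.2 : ℝ) • (p.1 : V)‖ : ℂ) ^ 2) =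
      ((inner ℝ w (p.1 : V) : ℝ) : ℂ) ^ n *
        (((p.2 : ℝ) ^ n * Real.exp (-(p.2 : ℝ) ^ 2) : ℝ) : ℂ) := fun p => by
    have hp : ‖(p.1 : V)‖ = 1 := by simp
    rw [inner_smul_right, norm_smul, hp, mul_one, Real.norm_of_nonneg (le_of_lt p.2.2)]
    push_cast
    ring
  rw [integral_eq_integral_toSphere_prod]
  simp_rw [e]
  rw [integral_prod_mul (fun θ : Metric.sphere (0 : V) 1 => ((inner ℝ w (θ : V) : ℝ) : ℂ) ^ n)
    (fun r : Ioi (0 : ℝ) => ((((r : ℝ) ^ n * Real.exp (-(r : ℝ) ^ 2) : ℝ)) : ℂ)), sphereMoment]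
  congr 1
  rw [integral_complex_ofReal, integral_volumeIoiPow (g := fun r => r ^ n * Real.exp (-r ^ 2))]
  congr 1
  have h := integral_rpow_mul_exp_neg_rpow (p := 2) (q := (n : ℝ) + Module.finrank ℝ V - 1)
    two_pos (by
      have : (0 : ℝ) ≤ n := Nat.cast_nonneg n
      have : (1 : ℝ) ≤ Module.finrank ℝ V := by exact_mod_cast hd
      linarith)
  rw [sub_add_cancel] at h
  rw [← h]
  refine setIntegral_congr_fun measurableSet_Ioi fun r _ => ?_
  have e2 : (n : ℝ) + Module.finrank ℝ V - 1 = ((n + (Module.finrank ℝ V - 1) : ℕ) : ℝ) := by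
    push_cast [Nat.cast_sub hd]; ring
  simp only [smul_eq_mul]
  rw [e2, Real.rpow_natCast, Real.rpow_two, pow_add]
  ring

/-- Equate the coefficients of the two expansions of the Gaussian transform and divide by the
nonzero radial Gamma factor. -/
lemma sphereMoment_div_factorial [Nontrivial V] (w : V) (n : ℕ) :
    sphereMoment w n / n.factorial = if Even n then
      ((2 * Real.pi ^ ((Module.finrank ℝ V : ℝ) / 2) * ‖w‖ ^ n / (4 ^ (n / 2) * (n / 2).factorial *
        Real.Gamma (((n : ℝ) + Module.finrank ℝ V) / 2)) : ℝ) : ℂ) else 0 := by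
  have h := congrFun (eq_of_hasSum_pow_eq (hasSum_gaussian_moments w)
    (hasSum_gaussian_transform w)) n
  have hd : (1 : ℝ) ≤ Module.finrank ℝ V := by exact_mod_cast Module.finrank_pos (R := ℝ) (M := V)
  have hG : Real.Gamma (((n : ℝ) + Module.finrank ℝ V) / 2) ≠ 0 :=
    (Real.Gamma_pos_of_pos (by positivity)).ne'
  have hG' : (Real.Gamma (((n : ℝ) + Module.finrank ℝ V) / 2) : ℂ) ≠ 0 :=
    Complex.ofReal_ne_zero.2 hG
  have hn : (n.factorial : ℂ) ≠ 0 := by exact_mod_cast n.factorial_ne_zero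
  rw [gaussian_moment_eq] at h
  have hpi : (Real.pi : ℂ) ^ (Module.finrank ℝ V / 2 : ℂ) =
      ((Real.pi ^ ((Module.finrank ℝ V : ℝ) / 2) : ℝ) : ℂ) := by
    rw [Complex.ofReal_cpow Real.pi_pos.le]; push_cast; rfl
  have h2 : sphereMoment w n / n.factorial = 2 * ((n.factorial : ℂ)⁻¹ * (sphereMoment w n *
      ((1 / 2 * Real.Gamma (((n : ℝ) + Module.finrank ℝ V) / 2) : ℝ) : ℂ))) /
        Real.Gamma (((n : ℝ) + Module.finrank ℝ V) / 2) := by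
    push_cast
    field_simp
  rw [h2, h]
  split_ifs
  · rw [hpi, ← Complex.ofReal_mul, ← Complex.ofReal_ofNat, ← Complex.ofReal_mul,
      ← Complex.ofReal_div]
    congr 1
    simp only [div_eq_mul_inv, mul_inv]
    ring
  · simp

/-- The Fourier transform of the unit sphere is a Bessel function. -/
lemma integral_toSphere_cexp [Nontrivial V] (w : V) (r : ℝ) :
    ∫ θ : Metric.sphere (0 : V) 1,
        Complex.exp (-(((inner ℝ w (r • (θ : V)) : ℝ) : ℂ) * Complex.I))
        ∂(volume : Measure V).toSphere =
      ((2 * Real.pi ^ ((Module.finrank ℝ V : ℝ) / 2) *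
        besselEntire ((Module.finrank ℝ V : ℝ) / 2 - 1) ((r * ‖w‖) ^ 2 / 4) : ℝ) : ℂ) := by
  have hsum : Summable fun n : ℕ => (‖w‖ * |r|) ^ n / n.factorial :=
    Real.summable_pow_div_factorial (‖w‖ * |r|)
  have h := hasSum_integral_of_dominated_convergence (ι := ℕ)
    (μ := (volume : Measure V).toSphere)
    (F := fun n θ => (-(((inner ℝ w (r • (θ : V)) : ℝ) : ℂ) * Complex.I)) ^ n / n.factorial)
    (f := fun θ => Complex.exp (-(((inner ℝ w (r • (θ : V)) : ℝ) : ℂ) * Complex.I)))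
    (fun n _ => (‖w‖ * |r|) ^ n / n.factorial)
    (fun n => Continuous.aestronglyMeasurable (by fun_prop)) (fun n => ae_of_all _ fun θ => ?_)
    (ae_of_all _ fun _ => hsum) (integrable_const _)
    (ae_of_all _ fun θ => ?_)
  · have e : ∀ n : ℕ, ∫ θ : Metric.sphere (0 : V) 1,
        (-(((inner ℝ w (r • (θ : V)) : ℝ) : ℂ) * Complex.I)) ^ n / n.factorial
          ∂(volume : Measure V).toSphere =
        (-(r * Complex.I)) ^ n * (sphereMoment w n / n.factorial) := fun n => by
      rw [sphereMoment, ← integral_div, ← integral_const_mul]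
      refine integral_congr_ae (ae_of_all _ fun θ => ?_)
      simp only
      rw [inner_smul_right, mul_div_assoc', ← mul_pow]
      push_cast
      congr 2
      ring
    simp_rw [e] at h
    refine h.unique ?_
    rw [← add_zero (Complex.ofReal (2 * _ * _))]
    refine HasSum.even_add_odd ?_ ?_
    · have hs := (summable_besselCoeff_mul_pow ((Module.finrank ℝ V : ℝ) / 2 - 1)
        ((r * ‖w‖) ^ 2 / 4)).hasSum.mul_left (2 * Real.pi ^ ((Module.finrank ℝ V : ℝ) / 2))
      refine (Complex.hasSum_ofReal.2 hs).congr_fun fun m => ?_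
      have hI : (-((r : ℂ) * Complex.I)) ^ (2 * m) = (((-1) ^ m * r ^ (2 * m) : ℝ) : ℂ) := by
        rw [pow_mul, pow_mul, neg_sq, mul_pow, Complex.I_sq, mul_comm, mul_pow]
        push_cast
        rfl
      rw [sphereMoment_div_factorial, if_pos (even_two_mul m), Nat.mul_div_cancel_left m two_pos,
        hI, ← Complex.ofReal_mul]
      congr 1
      -- The Gamma factor of the moment of order 2m is exactly the one in the Bessel coefficient of
      -- order d/2 - 1.
      have eG : (((2 * m : ℕ) : ℝ) + Module.finrank ℝ V) / 2 =
          (m : ℝ) + ((Module.finrank ℝ V : ℝ) / 2 - 1) + 1 := by push_cast; ring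
      rw [eG, besselCoeff]
      simp only [div_eq_mul_inv, mul_inv, mul_pow, inv_pow, ← pow_mul]
      ring
    · refine hasSum_zero.congr_fun fun m => ?_
      rw [sphereMoment_div_factorial, if_neg (by simp), mul_zero]
  · have hθ : ‖(θ : V)‖ = 1 := by simp
    rw [norm_div, norm_pow, norm_neg, norm_mul, Complex.norm_I, mul_one, Complex.norm_natCast,
      Complex.norm_real]
    gcongr
    refine (norm_inner_le_norm w _).trans ?_
    rw [norm_smul, hθ, mul_one, Real.norm_eq_abs]
  · rw [Complex.exp_eq_exp_ℂ]
    exact NormedSpace.expSeries_div_hasSum_exp _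

end Moments

/-! ### Reduction to a Hankel transform -/

/-- The Fourier transform of an integrable radial function is a Hankel transform. -/
theorem spectralDensity_eq {d : ℕ} (hd : 1 ≤ d) {κ : ℝ → ℝ} (hκ : Integrable (radialFun d κ))
    {ω : EuclideanSpace ℝ (Fin d)} (hω : ω ≠ 0) :
    spectralDensity d κ ω = (((1 / ‖ω‖) ^ ((d : ℝ) / 2 - 1) * ∫ r in Ioi (0 : ℝ),
      κ r * (r ^ ((d : ℝ) / 2) * besselJ ((d : ℝ) / 2 - 1) (r * ‖ω‖)) : ℝ) : ℂ) := by
  have hw : 0 < ‖ω‖ := norm_pos_iff.2 hω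
  have : Nontrivial (EuclideanSpace ℝ (Fin d)) := ⟨ω, 0, hω⟩
  have hint : Integrable (fun z : EuclideanSpace ℝ (Fin d) =>
      Complex.exp (-(((inner ℝ ω z : ℝ) : ℂ) * Complex.I)) * radialFun d κ z) := by
    refine hκ.bdd_mul (c := 1) (Continuous.aestronglyMeasurable (by fun_prop))
      (ae_of_all _ fun z => ?_)
    rw [← neg_mul, ← Complex.ofReal_neg, Complex.norm_exp_ofReal_mul_I]
  rw [spectralDensity, unitaryFourier, integral_eq_integral_Ioi_integral_toSphere _ hint,
    finrank_euclideanSpace_fin]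
  have e : ∀ r ∈ Ioi (0 : ℝ), r ^ (d - 1) • ∫ θ : Metric.sphere (0 : EuclideanSpace ℝ (Fin d)) 1,
      Complex.exp (-(((inner ℝ ω (r • (θ : EuclideanSpace ℝ (Fin d))) : ℝ) : ℂ) * Complex.I)) *
        radialFun d κ (r • (θ : EuclideanSpace ℝ (Fin d)))
        ∂(volume : Measure (EuclideanSpace ℝ (Fin d))).toSphere =
      (((2 * Real.pi) ^ ((d : ℝ) / 2) * (1 / ‖ω‖) ^ ((d : ℝ) / 2 - 1) *
        (κ r * (r ^ ((d : ℝ) / 2) * besselJ ((d : ℝ) / 2 - 1) (r * ‖ω‖))) : ℝ) : ℂ) := by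
    intro r hr
    have hr : 0 < r := hr
    have e1 : ∀ θ : Metric.sphere (0 : EuclideanSpace ℝ (Fin d)) 1,
        radialFun d κ (r • (θ : EuclideanSpace ℝ (Fin d))) = (κ r : ℂ) := fun θ => by
      have hθ : ‖(θ : EuclideanSpace ℝ (Fin d))‖ = 1 := by simp
      rw [radialFun, norm_smul, hθ, mul_one, Real.norm_of_nonneg hr.le]
    simp_rw [e1]
    rw [integral_mul_const, integral_toSphere_cexp, finrank_euclideanSpace_fin,
      ← Complex.ofReal_mul, Complex.real_smul, ← Complex.ofReal_mul]
    congr 1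
    -- The polar weight r^(d-1) is r^(d/2 + (d/2 - 1)), the power left when r^(d/2) J_{d/2-1}(r‖ω‖)
    -- is split into a power and an entire factor.
    rw [rpow_mul_besselJ_mul _ _ hr hw, ← Real.rpow_natCast r (d - 1), Nat.cast_sub hd,
      show (d : ℝ) / 2 + ((d : ℝ) / 2 - 1) = d - (1 : ℕ) by push_cast; ring,
      Real.mul_rpow zero_le_two Real.pi_pos.le, Real.div_rpow zero_le_one hw.le, Real.one_rpow,
      Real.div_rpow hw.le zero_le_two, Real.rpow_sub_one two_ne_zero]
    have h1 : (2 : ℝ) ^ ((d : ℝ) / 2) ≠ 0 := by positivity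
    have h2 : ‖ω‖ ^ ((d : ℝ) / 2 - 1) ≠ 0 := by positivity
    field_simp
  rw [setIntegral_congr_fun measurableSet_Ioi e, integral_complex_ofReal, integral_const_mul,
    ← Complex.ofReal_mul, Real.rpow_neg (by positivity)]
  congr 1
  have h1 : (2 * Real.pi) ^ ((d : ℝ) / 2) ≠ 0 := by positivity
  field_simp

/-! ### The two kernels: form on the sphere and integrability -/

/-- For unit vectors ‖x - y‖²/2 - 1 = -⟨x, y⟩, and arccos(-u) = π - arccos u. -/
lemma arcCosineZero_inner {E : Type*} [NormedAddCommGroup E] [InnerProductSpace ℝ E] {x y : E}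
    (hx : ‖x‖ = 1) (hy : ‖y‖ = 1) : arcCosineZero (inner ℝ x y) = kappaZero ‖x - y‖ := by
  have h2 : ‖x - y‖ ≤ 2 := (norm_sub_le x y).trans (by rw [hx, hy]; norm_num)
  have h : ‖x - y‖ ^ 2 / 2 - 1 = -inner ℝ x y := by
    rw [norm_sub_sq_real, hx, hy]; ring
  rw [kappaZero, if_pos h2, h, Real.arccos_neg, arcCosineZero]
  field_simp

lemma integrable_radialFun {d : ℕ} {κ : ℝ → ℝ} (hm : Measurable κ) {C R : ℝ}
    (hb : ∀ z, 0 ≤ z → |κ z| ≤ C) (h0 : ∀ z, R < z → κ z = 0) : Integrable (radialFun d κ) := by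
  have hs : Function.support (radialFun d κ) ⊆ Metric.closedBall 0 R := fun z hz => by
    rw [mem_closedBall_zero_iff]
    by_contra h
    exact hz (by rw [radialFun, h0 _ (not_le.1 h), Complex.ofReal_zero])
  rw [← integrableOn_iff_integrable_of_support_subset hs]
  refine Measure.integrableOn_of_bounded (M := C) measure_closedBall_lt_top.ne
    (Complex.measurable_ofReal.comp (hm.comp measurable_norm)).aestronglyMeasurable
    (ae_of_all _ fun z => ?_)
  rw [radialFun, Complex.norm_real]
  exact hb _ (norm_nonneg z)

lemma kappaZero_of_lt {z : ℝ} (hz : 2 < z) : kappaZero z = 0 := if_neg (not_le.2 hz)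

lemma kappaOne_of_lt {z : ℝ} (hz : 2 < z) : kappaOne z = 0 := if_neg (not_le.2 hz)

lemma integrable_radialFun_kappaZero (d : ℕ) : Integrable (radialFun d kappaZero) := by
  refine integrable_radialFun (C := 1) ?_ (fun z _ => ?_) fun z => kappaZero_of_lt
  · refine Measurable.ite measurableSet_Iic ?_ measurable_const
    exact (Real.continuous_arccos.comp (by fun_prop)).measurable.const_mul _
  · rw [kappaZero]
    split_ifs
    · rw [abs_of_nonneg (mul_nonneg (by positivity) (Real.arccos_nonneg _)), one_div,
        inv_mul_le_one₀ Real.pi_pos]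
      exact Real.arccos_le_pi _
    · simp

lemma integrable_radialFun_kappaOne (d : ℕ) : Integrable (radialFun d kappaOne) := by
  refine integrable_radialFun (C := 1) ?_ (fun z hz => ?_) fun z => kappaOne_of_lt
  · refine Measurable.ite measurableSet_Iic ?_ measurable_const
    exact Continuous.measurable (by fun_prop)
  · rw [kappaOne]
    split_ifs with h
    · have h1 : √(4 - z ^ 2) ≤ 2 := by
        rw [Real.sqrt_le_left zero_le_two]; nlinarith [sq_nonneg z]
      rw [abs_of_nonneg (by positivity), div_mul_eq_mul_div, div_le_one (by positivity)]
      nlinarith [Real.pi_gt_three, mul_le_mul h h1 (Real.sqrt_nonneg _) zero_le_two]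
    · simp

/-! ### Termwise integration -/

/-- Dominated convergence with bound c_n |g|. Hypotheses on the open interval suffice because
endpoints are null; this matters since z = 0 and z = 2 correspond to arcsine arguments ±1, outside
`hasSum_arcsin`. -/
lemma hasSum_intervalIntegral_mul {f : ℕ → ℝ → ℝ} {φ g : ℝ → ℝ} {c : ℕ → ℝ} {a b : ℝ} (hab : a ≤ b)
    (hf : ∀ n, Continuous (f n)) (hc : Summable c) (hfc : ∀ n, ∀ z ∈ Ioo a b, |f n z| ≤ c n)
    (hg : IntervalIntegrable g volume a b) (h : ∀ z ∈ Ioo a b, HasSum (fun n => f n z) (φ z)) :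
    HasSum (fun n => ∫ z in a..b, f n z * g z) (∫ z in a..b, φ z * g z) := by
  have hmem : ∀ᵐ z : ℝ, z ∈ Set.uIoc a b → z ∈ Ioo a b := by
    filter_upwards [(countable_singleton b).ae_notMem volume] with z hz hz'
    rw [uIoc_of_le hab] at hz'
    exact ⟨hz'.1, lt_of_le_of_ne hz'.2 hz⟩
  refine intervalIntegral.hasSum_integral_of_dominated_convergence (fun n z => c n * |g z|)
    (fun n => (hf n).aestronglyMeasurable.mul hg.def'.aestronglyMeasurable) (fun n => ?_)
    (ae_of_all _ fun z _ => hc.mul_right _) ?_ ?_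
  · filter_upwards [hmem] with z hz hz'
    rw [norm_mul, Real.norm_eq_abs, Real.norm_eq_abs]
    exact mul_le_mul_of_nonneg_right (hfc n z (hz hz')) (abs_nonneg _)
  · simp_rw [tsum_mul_right]
    exact hg.abs.const_mul _
  · filter_upwards [hmem] with z hz hz'
    exact (h z (hz hz')).mul_right _

lemma intervalIntegral_congr_Ioo {f g : ℝ → ℝ} {a b : ℝ} (hab : a ≤ b) (h : EqOn f g (Ioo a b)) :
    ∫ z in a..b, f z = ∫ z in a..b, g z := by
  rw [intervalIntegral.integral_of_le hab, intervalIntegral.integral_of_le hab,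
    integral_Ioc_eq_integral_Ioo, integral_Ioc_eq_integral_Ioo]
  exact setIntegral_congr_fun measurableSet_Ioo h

lemma integral_Ioi_eq_intervalIntegral {κ g : ℝ → ℝ} {R : ℝ} (hR : 0 ≤ R)
    (h0 : ∀ z, R < z → κ z = 0) :
    ∫ z in Ioi (0 : ℝ), κ z * g z = ∫ z in (0 : ℝ)..R, κ z * g z := by
  rw [intervalIntegral.integral_of_le hR]
  refine setIntegral_eq_of_subset_of_forall_sdiff_eq_zero measurableSet_Ioi Ioc_subset_Ioi_self
    fun z hz => ?_
  have hz2 : R < z := by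
    by_contra h
    exact hz.2 ⟨hz.1, not_lt.1 h⟩
  rw [h0 z hz2, zero_mul]

lemma intervalIntegrable_hankelKernel {d : ℕ} (hd : 1 ≤ d) {w : ℝ} (hw : 0 < w) : IntervalIntegrable
    (fun z => z ^ ((d : ℝ) / 2) * besselJ ((d : ℝ) / 2 - 1) (z * w)) volume 0 2 := by
  have hd' : (1 : ℝ) ≤ d := by exact_mod_cast hd
  exact intervalIntegrable_rpow_mul_besselJ _ _ hw le_rfl zero_le_two (Or.inr (by linarith))

lemma intervalIntegrable_zeroTerm {d : ℕ} (hd : 1 ≤ d) {w : ℝ} (hw : 0 < w)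
    (j : ℕ) : IntervalIntegrable (zeroTerm d j w) volume 0 2 := by
  have h := (intervalIntegrable_hankelKernel hd hw).continuousOn_mul
    (g := fun z => (z ^ 2 / 2 - 1) ^ (2 * j + 1) * w) (by fun_prop)
  refine h.congr fun z _ => ?_
  simp only [zeroTerm]; ring

lemma intervalIntegrable_oneTerm {d : ℕ} (hd : 1 ≤ d) {w : ℝ} (hw : 0 < w)
    (j : ℕ) : IntervalIntegrable (oneTerm d j w) volume 0 2 := by
  have hd' : (1 : ℝ) ≤ d := by exact_mod_cast hd
  have hj : (0 : ℝ) ≤ j := Nat.cast_nonneg j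
  exact intervalIntegrable_rpow_mul_besselJ _ _ hw le_rfl zero_le_two (Or.inr (by linarith))

lemma integral_zeroTerm {d : ℕ} (hd : 1 ≤ d) {w : ℝ} (hw : 0 < w)
    (j : ℕ) : ∫ z in (0 : ℝ)..2, zeroTerm d j w z =
    ∑ k ∈ Finset.range (2 * j + 2), (-1 : ℝ) ^ k * ((2 * j + 1).descFactorial k : ℝ) *
      (2 : ℝ) ^ ((d : ℝ) / 2 + (k : ℝ)) / w ^ k * besselJ ((d : ℝ) / 2 + (k : ℝ)) (2 * w) := by
  have hd' : (1 : ℝ) ≤ d := by exact_mod_cast hd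
  rw [← integral_pow_mul_rpow_mul_besselJ (2 * j + 1) hw (by positivity : (0 : ℝ) < (d : ℝ) / 2)]
  refine intervalIntegral.integral_congr fun z _ => ?_
  simp only [zeroTerm]; ring

lemma hasSum_integral_zeroTerm {d : ℕ} (hd : 1 ≤ d) {w : ℝ} (hw : 0 < w) :
    HasSum (fun j => arcsinCoeff j * ∫ z in (0 : ℝ)..2, zeroTerm d j w z)
      (∫ z in (0 : ℝ)..2, Real.arcsin (z ^ 2 / 2 - 1) *
        (w * (z ^ ((d : ℝ) / 2) * besselJ ((d : ℝ) / 2 - 1) (z * w)))) := by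
  have hab : ∀ z ∈ Ioo (0 : ℝ) 2, |z ^ 2 / 2 - 1| < 1 := fun z hz => by
    rw [abs_lt]; constructor <;> nlinarith [hz.1, hz.2]
  have h := hasSum_intervalIntegral_mul (f := fun j z => arcsinCoeff j * (z ^ 2 / 2 - 1) ^ (2 * j + 1))
    zero_le_two (fun n => by fun_prop) summable_arcsinCoeff (fun j z hz => ?_)
    ((intervalIntegrable_hankelKernel hd hw).const_mul w) (fun z hz => hasSum_arcsin (hab z hz))
  · refine h.congr_fun fun j => ?_
    rw [← intervalIntegral.integral_const_mul]
    refine intervalIntegral.integral_congr fun z _ => ?_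
    simp only [zeroTerm]; ring
  · rw [abs_mul, abs_pow, abs_of_nonneg (arcsinCoeff_nonneg j)]
    exact mul_le_of_le_one_right (arcsinCoeff_nonneg j) (pow_le_one₀ (abs_nonneg _) (hab z hz).le)

lemma hasSum_integral_oneTerm {d : ℕ} (hd : 1 ≤ d) {w : ℝ} (hw : 0 < w) :
    HasSum (fun j => sqrtCoeff j * ∫ z in (0 : ℝ)..2, oneTerm d j w z)
      (∫ z in (0 : ℝ)..2, √(4 - z ^ 2) / 2 *
        (z * (z ^ ((d : ℝ) / 2) * besselJ ((d : ℝ) / 2 - 1) (z * w)))) := by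
  have h := hasSum_intervalIntegral_mul (f := fun j z => sqrtCoeff j * z ^ (2 * j))
    zero_le_two (fun n => by fun_prop) summable_abs_sqrtCoeff (fun j z hz => ?_)
    ((intervalIntegrable_hankelKernel hd hw).continuousOn_mul (g := fun z => z) (by fun_prop))
    (fun z hz => hasSum_sqrtCoeff (abs_lt.2 ⟨by linarith [hz.1], hz.2⟩))
  · refine h.congr_fun fun j => ?_
    rw [← intervalIntegral.integral_const_mul]
    refine intervalIntegral_congr_Ioo zero_le_two fun z hz => ?_
    have e : 2 * (j : ℝ) = ((2 * j : ℕ) : ℝ) := by push_cast; ring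
    simp only [oneTerm]
    rw [Real.rpow_add hz.1, Real.rpow_add_one hz.1.ne', e, Real.rpow_natCast]
    ring
  · rw [abs_mul, abs_of_nonneg (pow_nonneg hz.1.le _), pow_mul]
    refine mul_le_mul_of_nonneg_left (pow_le_pow_left₀ (sq_nonneg z) ?_ j) (abs_nonneg _)
    nlinarith [hz.1, hz.2]

lemma integral_kappaZero_mul_hankelKernel {d : ℕ} (hd : 1 ≤ d) {w : ℝ} (hw : 0 < w) :
    ∫ z in (0 : ℝ)..2, kappaZero z * (z ^ ((d : ℝ) / 2) * besselJ ((d : ℝ) / 2 - 1) (z * w)) =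
      2 ^ ((d : ℝ) / 2 - 1) / w * besselJ ((d : ℝ) / 2) (2 * w) - 1 / Real.pi * (1 / w) *
        ∑' j : ℕ, arcsinCoeff j * ∫ z in (0 : ℝ)..2, zeroTerm d j w z := by
  have hd' : (1 : ℝ) ≤ d := by exact_mod_cast hd
  have hI := (intervalIntegrable_hankelKernel hd hw).const_mul w
  -- The exponent 0 case integrates the constant π/2 of arccos = π/2 - arcsin and gives the closed
  -- Bessel term.
  have h0 := integral_pow_mul_rpow_mul_besselJ 0 hw (by positivity : (0 : ℝ) < (d : ℝ) / 2)
  simp only [pow_zero, one_mul, zero_add, Finset.sum_range_one, Nat.descFactorial_zero,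
    Nat.cast_one, Nat.cast_zero, add_zero, div_one] at h0
  rw [(hasSum_integral_zeroTerm hd hw).tsum_eq, Real.rpow_sub_one two_ne_zero]
  have e : (2 : ℝ) ^ ((d : ℝ) / 2) / 2 / w * besselJ ((d : ℝ) / 2) (2 * w) =
      1 / 2 * (1 / w) * (2 ^ ((d : ℝ) / 2) * besselJ ((d : ℝ) / 2) (2 * w)) := by
    field_simp
  rw [e, ← h0, ← intervalIntegral.integral_const_mul, ← intervalIntegral.integral_const_mul,
    ← intervalIntegral.integral_sub (hI.const_mul _)
      ((hI.continuousOn_mul (Continuous.continuousOn (by fun_prop))).const_mul _)]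
  refine intervalIntegral_congr_Ioo zero_le_two fun z hz => ?_
  simp only [kappaZero]
  rw [if_pos hz.2.le, Real.arccos_eq_pi_div_two_sub_arcsin]
  field_simp

lemma integral_kappaOne_mul_hankelKernel {d : ℕ} (hd : 1 ≤ d) {w : ℝ} (hw : 0 < w) :
    ∫ z in (0 : ℝ)..2, kappaOne z * (z ^ ((d : ℝ) / 2) * besselJ ((d : ℝ) / 2 - 1) (z * w)) =
      1 / Real.pi * ∑' j : ℕ, sqrtCoeff j * ∫ z in (0 : ℝ)..2, oneTerm d j w z := by
  rw [(hasSum_integral_oneTerm hd hw).tsum_eq, ← intervalIntegral.integral_const_mul]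
  refine intervalIntegral_congr_Ioo zero_le_two fun z hz => ?_
  simp only [kappaOne]
  rw [if_pos hz.2.le]
  field_simp

/-! ### The spectral densities -/

theorem spectralDensity_kappaZero {d : ℕ} (hd : 1 ≤ d) {ω : EuclideanSpace ℝ (Fin d)}
    (hω : ω ≠ 0) : spectralDensity d kappaZero ω =
      ((1 / ‖ω‖ * (2 / ‖ω‖) ^ ((d : ℝ) / 2 - 1) * besselJ ((d : ℝ) / 2) (2 * ‖ω‖)
        - 1 / Real.pi * (1 / ‖ω‖) ^ ((d : ℝ) / 2) *
          ∑' j : ℕ, arcsinCoeff j * ∫ z in (0 : ℝ)..2, zeroTerm d j ‖ω‖ z : ℝ) : ℂ) := by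
  have hw : 0 < ‖ω‖ := norm_pos_iff.2 hω
  rw [spectralDensity_eq hd (integrable_radialFun_kappaZero d) hω,
    integral_Ioi_eq_intervalIntegral zero_le_two fun z => kappaZero_of_lt,
    integral_kappaZero_mul_hankelKernel hd hw]
  congr 1
  have h1 : (2 / ‖ω‖) ^ ((d : ℝ) / 2 - 1) = 2 ^ ((d : ℝ) / 2 - 1) * (1 / ‖ω‖) ^ ((d : ℝ) / 2 - 1) := by
    rw [← Real.mul_rpow zero_le_two (by positivity), mul_one_div]
  have h2 : (1 / ‖ω‖) ^ ((d : ℝ) / 2) = (1 / ‖ω‖) ^ ((d : ℝ) / 2 - 1) * (1 / ‖ω‖) := by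
    rw [← Real.rpow_add_one (by positivity), sub_add_cancel]
  rw [h1, h2]
  ring

theorem spectralDensity_kappaOne {d : ℕ} (hd : 1 ≤ d) {ω : EuclideanSpace ℝ (Fin d)}
    (hω : ω ≠ 0) : spectralDensity d kappaOne ω =
      ((1 / Real.pi * (1 / ‖ω‖) ^ ((d : ℝ) / 2 - 1) *
        ∑' j : ℕ, sqrtCoeff j * ∫ z in (0 : ℝ)..2, oneTerm d j ‖ω‖ z : ℝ) : ℂ) := by
  rw [spectralDensity_eq hd (integrable_radialFun_kappaOne d) hω,
    integral_Ioi_eq_intervalIntegral zero_le_two fun z => kappaOne_of_lt,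
    integral_kappaOne_mul_hankelKernel hd (norm_pos_iff.2 hω)]
  congr 1
  ring

theorem mainTheorem6 (d : ℕ) (hd : 1 ≤ d) :
    -- the kernel on the unit sphere is the radial function `kappaZero` of the distance
    (∀ x x' : EuclideanSpace ℝ (Fin d), ‖x‖ = 1 → ‖x'‖ = 1 →
      arcCosineZero (inner ℝ x x') = kappaZero ‖x - x'‖) ∧
    -- the Fourier integrals converge absolutely
    MeasureTheory.Integrable (radialFun d kappaZero) MeasureTheory.volume ∧
    MeasureTheory.Integrable (radialFun d kappaOne) MeasureTheory.volume ∧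
    -- zero order
    (∀ ω : EuclideanSpace ℝ (Fin d), ω ≠ 0 →
      (∀ j : ℕ, IntervalIntegrable (zeroTerm d j ‖ω‖) MeasureTheory.volume 0 2) ∧
      Summable (fun j : ℕ => arcsinCoeff j * ∫ z in (0 : ℝ)..2, zeroTerm d j ‖ω‖ z) ∧
      spectralDensity d kappaZero ω =
        ((1 / ‖ω‖ * (2 / ‖ω‖) ^ ((d : ℝ) / 2 - 1) * besselJ ((d : ℝ) / 2) (2 * ‖ω‖)
          - 1 / Real.pi * (1 / ‖ω‖) ^ ((d : ℝ) / 2) *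
            ∑' j : ℕ, arcsinCoeff j * ∫ z in (0 : ℝ)..2, zeroTerm d j ‖ω‖ z : ℝ) : ℂ) ∧
      -- the integrals, computed by parts
      (∀ j : ℕ, ∫ z in (0 : ℝ)..2, zeroTerm d j ‖ω‖ z =
        ∑ k ∈ Finset.range (2 * j + 2),
          (-1 : ℝ) ^ k * ((2 * j + 1).descFactorial k : ℝ) *
            (2 : ℝ) ^ ((d : ℝ) / 2 + (k : ℝ)) / ‖ω‖ ^ k *
            besselJ ((d : ℝ) / 2 + (k : ℝ)) (2 * ‖ω‖))) ∧
    -- the recurrence formula, for definite integrals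
    (∀ a v x y : ℝ, 0 ≤ x → x ≤ y → (0 < x ∨ 0 < a + v) →
      IntervalIntegrable (fun z => z ^ a * besselJ (v + 1) z) MeasureTheory.volume x y ∧
      IntervalIntegrable (fun z => z ^ (a - 1) * besselJ v z) MeasureTheory.volume x y ∧
      IntervalIntegrable (fun z => z ^ a * besselJ (v - 1) z) MeasureTheory.volume x y ∧
      ∫ z in x..y, z ^ a * besselJ (v + 1) z =
        2 * v * (∫ z in x..y, z ^ (a - 1) * besselJ v z)
          - ∫ z in x..y, z ^ a * besselJ (v - 1) z) ∧
    -- first order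
    (∀ ω : EuclideanSpace ℝ (Fin d), ω ≠ 0 →
      (∀ j : ℕ, IntervalIntegrable (oneTerm d j ‖ω‖) MeasureTheory.volume 0 2) ∧
      Summable (fun j : ℕ => sqrtCoeff j * ∫ z in (0 : ℝ)..2, oneTerm d j ‖ω‖ z) ∧
      spectralDensity d kappaOne ω =
        ((1 / Real.pi * (1 / ‖ω‖) ^ ((d : ℝ) / 2 - 1) *
          ∑' j : ℕ, sqrtCoeff j * ∫ z in (0 : ℝ)..2, oneTerm d j ‖ω‖ z : ℝ) : ℂ)) := by
  refine ⟨fun x x' hx hx' => arcCosineZero_inner hx hx', integrable_radialFun_kappaZero d,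
    integrable_radialFun_kappaOne d, fun ω hω => ?_,
    fun a v x y hx hxy h => besselJ_integral_recurrence a v hx hxy h, fun ω hω => ?_⟩
  · have hw : 0 < ‖ω‖ := norm_pos_iff.2 hω
    exact ⟨intervalIntegrable_zeroTerm hd hw, (hasSum_integral_zeroTerm hd hw).summable,
      spectralDensity_kappaZero hd hω, integral_zeroTerm hd hw⟩
  · have hw : 0 < ‖ω‖ := norm_pos_iff.2 hω
    exact ⟨intervalIntegrable_oneTerm hd hw, (hasSum_integral_oneTerm hd hw).summable,
      spectralDensity_kappaOne hd hω⟩
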